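/- A point cloud of size $n$ is $P=(p_1,\dots,p_n)\in\mathbb{R}^{n\times 3}$. Two point clouds are isomorphic if they have the same size and agree up to a permutation of the points, an element of $O(3)$ and a translation. **Symmetry.** Given node features $x_1,\dots,x_n\in X$ of $P$, the center set of $P$ with respect to $x$ is $$\Big\{\tfrac{\sum_i m(x_i)\,p_i}{\sum_i m(x_i)} \;:\; m:X\to\mathbb{R},\ \sum_i m(x_i)\neq 0\Big\}.$$ $P$ is symmetric with respect to $x$ if this set has exactly one element, and asymmetric otherwise. $P$ is $\mathcal{C}$-asymmetric if it is asymmetric with respect to the distances $\|p_i-\tfrac1n\sum_j p_j\|$ of its points to its geometric center. **DisGNN.** A fully-connected DisGNN starts with the same embedding $h_i^{(0)}\in\mathbb{R}^{d_0}$ at every node (of every cloud) and iterates $$h_i^{(l+1)}=f^{(l)}_{\rm update}\Big(h_i^{(l)},\,f^{(l)}_{\rm aggr}\big(\{\!\!\{(h_j^{(l)},\|p_i-p_j\|)\mid j\in[n]\}\!\!\}\big)\Big)\in\mathbb{R}^{d_{l+1}},$$ where all functions $f^{(l)}_{\rm update}$ and $f^{(l)}_{\rm aggr}$ (the latter on finite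 multisets, with values in some $\mathbb{R}^{e_l}$) are injective. $P$ is $\mathcal{D}$-asymmetric if it is asymmetric with respect to the embeddings $h_i^{(T)}$, where $T$ is the first round from which the partition of the nodes of $P$ into classes of equal embedding no longer changes. The output after $L$ rounds is $f_{\rm out}(\{\!\!\{h_i^{(L)}\mid i\in[n]\}\!\!\})\in\mathbb{R}^k$ with $f_{\rm out}$ injective on finite multisets. DisGNN with $L$ rounds identifies $P$ if its output on $P$ differs from its output on every point cloud (of any size) that is not isomorphic to $P$. **Theorem.** Let $P\in\mathbb{R}^{n\times 3}$ be any point cloud and consider any such DisGNN. If $P$ is $\mathcal{C}$-asymmetric, then $P$ is $\mathcal{D}$-asymmetric; and if $P$ is $\mathcal{D}$-asymmetric, then for every number $L\ge n+4$ of rounds and every injective $f_{\rm out}$, DisGNN with $L$ rounds identifies $P$. -/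

import Mathlib

noncomputable section

/-- Euclidean three-space. -/
abbrev Space3 : Type := EuclideanSpace ℝ (Fin 3)

/-- An unlabelled point cloud with `n` nodes; `P i` is the position of node `i`. -/
abbrev PointCloud (n : ℕ) : Type := Fin n → Space3

/-- Real feature vectors of dimension `d`. -/
abbrev Feature (d : ℕ) : Type := Fin d → ℝ

/-- Isomorphism of point clouds: equal up to a relabelling of the nodes, an element of `O(3)`
(a linear isometry of three-space) and a translation. The bijection `σ` forces equal sizes. -/
def PointCloud.Isomorphic {n₁ n₂ : ℕ} (P₁ : PointCloud n₁) (P₂ : PointCloud n₂) : Prop :=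
  ∃ (σ : Fin n₁ ≃ Fin n₂) (R : Space3 ≃ₗᵢ[ℝ] Space3) (t : Space3),
    ∀ i, P₂ (σ i) = R (P₁ i) + t

/-- `f` identifies `P` if its value at `P` differs from its value at every point cloud, of any
size, that is not isomorphic to `P`. -/
def Identifies {S : Type*} (f : ∀ n : ℕ, PointCloud n → S) {n : ℕ} (P : PointCloud n) : Prop :=
  ∀ (n' : ℕ) (P' : PointCloud n'), ¬ P.Isomorphic P' → f n P ≠ f n' P'

/-- The set of barycenters of `P` for all (possibly signed) mass functions `m` of the node
features `x` whose total mass does not vanish. -/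
def centerSet {n : ℕ} {X : Type*} (P : PointCloud n) (x : Fin n → X) : Set Space3 :=
  {c | ∃ m : X → ℝ, ∑ i, m (x i) ≠ 0 ∧ c = (∑ i, m (x i))⁻¹ • ∑ i, m (x i) • P i}

/-- `P` is symmetric with respect to the node features `x` if there is exactly one barycenter. -/
def IsSymmetric {n : ℕ} {X : Type*} (P : PointCloud n) (x : Fin n → X) : Prop :=
  (centerSet P x).encard = 1

/-- `P` is asymmetric with respect to the node features `x` if it is not symmetric. -/
def IsAsymmetric {n : ℕ} {X : Type*} (P : PointCloud n) (x : Fin n → X) : Prop :=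
  ¬ IsSymmetric P x

/-- The geometric center of a point cloud. -/
def PointCloud.center {n : ℕ} (P : PointCloud n) : Space3 :=
  (n : ℝ)⁻¹ • ∑ i, P i

/-- The center distance encoding `𝒞`: the distance of each node to the geometric center. -/
def centerEncoding {n : ℕ} (P : PointCloud n) (i : Fin n) : ℝ :=
  dist (P i) P.center

/-- The layers of a DisGNN on unlabelled point clouds: a common initial node embedding (there are
no initial node features), and for every layer `l` an aggregation function on finite multisets of
(neighbor embedding, distance) pairs and an update function. -/
structure DisGNN where
  /-- dimension of the node embeddings at layer `l` -/
  dim : ℕ → ℕ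
  /-- dimension of the aggregated messages at layer `l` -/
  msgDim : ℕ → ℕ
  init : Feature (dim 0)
  aggr : ∀ l : ℕ, Multiset (Feature (dim l) × ℝ) → Feature (msgDim l)
  update : ∀ l : ℕ, Feature (dim l) → Feature (msgDim l) → Feature (dim (l + 1))

namespace DisGNN

/-- The maximally expressive form: all aggregation and update functions are injective. -/
def IsInjective (M : DisGNN) : Prop :=
  ∀ l : ℕ, Function.Injective (M.aggr l) ∧ Function.Injective (Function.uncurry (M.update l))

/-- The node embeddings `h_i^{(l)}` of fully connected message passing: every node aggregates over
all nodes, itself included. -/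
def embed (M : DisGNN) {n : ℕ} (P : PointCloud n) : ∀ l : ℕ, Fin n → Feature (M.dim l)
  | 0 => fun _ => M.init
  | l + 1 => fun i =>
      M.update l (M.embed P l i)
        (M.aggr l (Finset.univ.val.map fun j => (M.embed P l j, dist (P i) (P j))))

/-- The output of DisGNN with `L` layers and readout function `fout`. -/
def output (M : DisGNN) (L : ℕ) {k : ℕ} (fout : Multiset (Feature (M.dim L)) → Feature k)
    (n : ℕ) (P : PointCloud n) : Feature k :=
  fout (Finset.univ.val.map (M.embed P L))

/-- From round `T` on, the partition of the nodes of `P` by their embeddings no longer changes. -/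
def StableFrom (M : DisGNN) {n : ℕ} (P : PointCloud n) (T : ℕ) : Prop :=
  ∀ l, T ≤ l → ∀ i j, M.embed P l i = M.embed P l j ↔ M.embed P T i = M.embed P T j

/-- The first round from which the partition of the nodes is stable. (Such a round exists whenever
`M` is injective, as the partitions then only get finer.) -/
def stableRound (M : DisGNN) {n : ℕ} (P : PointCloud n) : ℕ :=
  sInf {T | M.StableFrom P T}

/-- The DisGNN encoding `𝒟`: the node embeddings once their partition has stabilized. -/
def encoding (M : DisGNN) {n : ℕ} (P : PointCloud n) : Fin n → Feature (M.dim (M.stableRound P)) :=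
  M.embed P (M.stableRound P)

end DisGNN

end

/-! Equal embeddings after one more round mean a bijection of nodes preserving the previous
embeddings and the distances to the node. Hence embeddings determine weighted sums of squared
distances, and by Huygens' identity the distances from a node to barycenters whose masses are
functions of embeddings (`dist_massCenter_eq`). Unit masses give the geometric center, so the stable
partition refines the one by center distance; finer features have more barycenters, whence the first
claim.

For the second, the partition is stable by some round `T ≤ n`. Two distinct barycenters at round `T`
span an axis, and one more round fixes each node's height along it and distance from it. Two further
rounds give projections orthogonal to the axis: first onto the direction of one off-axis node `i`,
then onto that of any other node `j`. Choosing `j` angularly closest to the line of `i` leaves an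
empty sector, and `exists_equiv_of_adjacent_projections` recovers the cloud by reflecting this
sector around the circle. -/

/-! ### Matching finite families by counting -/

/-- Number of indices at which the pair `(z, t)` takes the value `(w, s)`. -/
noncomputable def pairCount {ι : Type*} [Fintype ι] (z : ι → ℂ) (t : ι → ℝ) (w : ℂ) (s : ℝ) : ℤ :=
  open Classical in ∑ k, if z k = w ∧ t k = s then 1 else 0

theorem exists_equiv_of_map_univ_eq {ι κ α : Type*} [Fintype ι] [Fintype κ] {f : ι → α} {g : κ → α}
    (h : Finset.univ.val.map f = Finset.univ.val.map g) : ∃ σ : ι ≃ κ, ∀ i, g (σ i) = f i := by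
  classical
  have hc : ∀ a, Nonempty ({i // f i = a} ≃ {j // g j = a}) := by
    intro a
    apply Fintype.card_eq.mp
    have := congrArg (Multiset.count a) h
    rw [Multiset.count_map, Multiset.count_map] at this
    rw [Fintype.card_subtype, Fintype.card_subtype]
    simpa [Finset.card_def, Finset.filter_val, eq_comm] using this
  exact ⟨Equiv.ofFiberEquiv fun a => (hc a).some, fun i => Equiv.ofFiberEquiv_map _ i⟩

theorem pairCount_eq_card {ι : Type*} [Fintype ι] (z : ι → ℂ) (t : ι → ℝ) (w : ℂ) (s : ℝ)
    [DecidableEq (ℂ × ℝ)] :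
    pairCount z t w s = (Finset.univ.val.map fun k => (z k, t k)).count (w, s) := by
  classical
  rw [Multiset.count_map, ← Finset.filter_val, Finset.card_val, pairCount, Finset.sum_boole]
  norm_cast
  refine congrArg _ (Finset.filter_congr fun k _ => ?_)
  rw [Prod.mk.injEq, @eq_comm _ w, @eq_comm _ s]

theorem exists_equiv_of_pairCount_eq {ι κ : Type*} [Fintype ι] [Fintype κ] {z : ι → ℂ} {t : ι → ℝ}
    {z' : κ → ℂ} {t' : κ → ℝ} (h : ∀ w s, pairCount z t w s = pairCount z' t' w s) :
    ∃ π : ι ≃ κ, ∀ k, z' (π k) = z k ∧ t' (π k) = t k := by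
  classical
  have : (Finset.univ.val.map fun k => (z k, t k)) = Finset.univ.val.map fun k => (z' k, t' k) := by
    ext ⟨w, s⟩
    have := h w s
    rw [pairCount_eq_card, pairCount_eq_card] at this
    exact_mod_cast this
  obtain ⟨π, hπ⟩ := exists_equiv_of_map_univ_eq this
  exact ⟨π, fun k => by simpa using hπ k⟩

theorem exists_of_pairCount_ne_zero {ι : Type*} [Fintype ι] {z : ι → ℂ} {t : ι → ℝ} {w : ℂ} {s : ℝ}
    (h : pairCount z t w s ≠ 0) : ∃ k, z k = w := by
  classical
  obtain ⟨k, -, hk⟩ := Finset.exists_ne_zero_of_sum_ne_zero h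
  by_contra! hne
  simp [hne k] at hk

theorem pairCount_mul {ι : Type*} [Fintype ι] (z : ι → ℂ) (t : ι → ℝ) (w : ℂ) (s : ℝ) {c : ℂ}
    (hc : c ≠ 0) : pairCount (fun k => z k * c) t (w * c) s = pairCount z t w s := by
  simp [pairCount, hc]

/-! ### Reconstructing a planar cloud from projections -/

open ComplexConjugate in
theorem Complex.eq_or_eq_conj_of_re_eq_of_norm_eq {a b : ℂ} (hr : a.re = b.re) (hn : ‖a‖ = ‖b‖) :
    a = b ∨ a = conj b := by
  have h : a.im ^ 2 = b.im ^ 2 := by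
    have h1 := Complex.sq_norm_sub_sq_re a
    have h2 := Complex.sq_norm_sub_sq_re b
    rw [← h1, ← h2, hr, hn]
  rcases sq_eq_sq_iff_eq_or_eq_neg.mp h with h | h
  · exact .inl (Complex.ext hr h)
  · exact .inr (Complex.ext hr (by simpa using h))

open ComplexConjugate in
/-- The real part and the norm determine a complex number up to conjugation, hence a family of
complex numbers up to swapping conjugates. -/
theorem pairCount_add_pairCount_conj {ι κ : Type*} [Fintype ι] [Fintype κ] {z : ι → ℂ} {t : ι → ℝ}
    {z' : κ → ℂ} {t' : κ → ℝ} (τ : ι ≃ κ) (ht : ∀ k, t' (τ k) = t k)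
    (hn : ∀ k, ‖z' (τ k)‖ = ‖z k‖) (hr : ∀ k, (z' (τ k)).re = (z k).re) (w : ℂ) (s : ℝ) :
    pairCount z t w s + pairCount z t (conj w) s =
      pairCount z' t' w s + pairCount z' t' (conj w) s := by
  classical
  have hconj : ∀ a b : ℂ, conj a = b ↔ a = conj b := fun a b =>
    ⟨fun h => by rw [← h, Complex.conj_conj], fun h => by rw [h, Complex.conj_conj]⟩
  simp only [pairCount, ← Finset.sum_add_distrib]
  rw [← Equiv.sum_comp τ]
  refine Finset.sum_congr rfl fun k _ => ?_
  rw [ht]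
  rcases Complex.eq_or_eq_conj_of_re_eq_of_norm_eq (hr k) (hn k) with h | h
  · rw [h]
  · simp only [h, hconj, Complex.conj_conj]
    exact add_comm _ _

/-- The two reflections compose to the translation by `2 * α`, so `v` is periodic; oddness kills the
fixed points `0` and `α`, and `[-α, α]` contains a full period. -/
theorem eq_zero_of_odd_of_reflect {v : ℝ → ℤ} {α : ℝ} (hα : 0 < α) (h0 : ∀ θ, v (-θ) = -v θ)
    (h1 : ∀ θ, v (2 * α - θ) = -v θ) (hv : ∀ θ, 0 < θ → θ < α → v θ = 0) (θ : ℝ) : v θ = 0 := by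
  have hper : Function.Periodic v (2 * α) := fun θ => by
    have := h1 (-θ)
    rw [h0, neg_neg] at this
    rw [← this]; congr 1; ring
  have hz : v 0 = 0 := by have := h0 0; rw [neg_zero] at this; omega
  have ha : v α = 0 := by
    have := h1 α
    rw [show 2 * α - α = α by ring] at this; omega
  have hnn : ∀ θ, 0 ≤ θ → θ ≤ α → v θ = 0 := fun θ h h' => by
    rcases h.eq_or_lt with rfl | h
    · exact hz
    rcases h'.eq_or_lt with rfl | h'
    · exact ha
    exact hv θ h h'
  obtain ⟨y, ⟨hy1, hy2⟩, hy⟩ := hper.exists_mem_Ico (by positivity) θ (-α)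
  rw [hy]
  rcases le_total 0 y with h | h
  · exact hnn y h (by linarith)
  · have := hnn (-y) (by linarith) (by linarith)
    rw [h0] at this; omega

open Complex ComplexConjugate in
/-- A planar cloud with heights `t` is determined by its projections to two lines through the
origin whose sector contains no point of the cloud. -/
theorem exists_equiv_of_adjacent_projections {ι κ : Type*} [Fintype ι] [Fintype κ] {z : ι → ℂ}
    {t : ι → ℝ} {z' : κ → ℂ} {t' : κ → ℝ} (τ₀ τ₁ : ι ≃ κ) (j : ι)
    (h0 : ∀ k, t' (τ₀ k) = t k ∧ ‖z' (τ₀ k)‖ = ‖z k‖ ∧ (z' (τ₀ k)).re = (z k).re)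
    (h1 : ∀ k, t' (τ₁ k) = t k ∧ ‖z' (τ₁ k)‖ = ‖z k‖ ∧
      (z' (τ₁ k) * conj (z' (τ₀ j))).re = (z k * conj (z j)).re)
    (hj : 0 < (z j).im) (hj' : 0 < (z' (τ₀ j)).im)
    (hmax : ∀ k, (z k).im ≠ 0 → (z k).re * ‖z j‖ ≤ (z j).re * ‖z k‖) :
    ∃ π : ι ≃ κ, ∀ k, z' (π k) = z k ∧ t' (π k) = t k := by
  have hjj : z' (τ₀ j) = z j := by
    rcases eq_or_eq_conj_of_re_eq_of_norm_eq (h0 j).2.2 (h0 j).2.1 with h | h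
    · exact h
    · have := congrArg im h
      simp only [conj_im] at this
      linarith
  have hne : z j ≠ 0 := fun h => by simp [h] at hj
  have hnpos : 0 < ‖z j‖ := norm_pos_iff.mpr hne
  set α := arg (z j) with hα
  have hα0 : 0 < α := by
    refine lt_of_le_of_ne (arg_nonneg_iff.mpr hj.le) fun h => ?_
    have := (arg_eq_zero_iff.mp (hα ▸ h.symm : arg (z j) = 0)).2
    linarith
  have hαπ : α ≤ Real.pi := arg_le_pi _
  have hpol : z j = ‖z j‖ * exp (α * I) := (norm_mul_exp_arg_mul_I _).symm
  -- Multiplication by `c` rotates the line of `z j` onto the real axis, so the second projection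
  -- also becomes a real part.
  set c : ℂ := exp (-(α * I)) with hc
  have hc0 : c ≠ 0 := exp_ne_zero _
  have hcn : ‖c‖ = 1 := by
    rw [hc, show -((α : ℂ) * I) = ((-α : ℝ) : ℂ) * I by push_cast; ring, norm_exp_ofReal_mul_I]
  have hcj : conj (z j) = ‖z j‖ * c := by
    conv_lhs => rw [hpol]
    rw [map_mul, conj_ofReal, ← exp_conj, map_mul, conj_ofReal, conj_I, hc]
    congr 2; ring
  have hre1 : ∀ k, (z' (τ₁ k) * c).re = (z k * c).re := fun k => by
    have := (h1 k).2.2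
    rw [hjj, hcj, mul_left_comm, mul_left_comm (z k), re_ofReal_mul, re_ofReal_mul] at this
    exact mul_left_cancel₀ hnpos.ne' this
  refine exists_equiv_of_pairCount_eq fun w s => ?_
  have href0 := pairCount_add_pairCount_conj (z := z) (z' := z') (t := t) (t' := t') τ₀
    (fun k => (h0 k).1) (fun k => (h0 k).2.1) (fun k => (h0 k).2.2)
  have href1 := pairCount_add_pairCount_conj (z := fun k => z k * c) (z' := fun k => z' k * c)
    (t := t) (t' := t') τ₁ (fun k => (h1 k).1) (fun k => by simp [(h1 k).2.1]) hre1
  -- Difference of the two clouds' counts on the circle through `w` at height `s`; each projection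
  -- makes it odd under reflection in its line.
  let v : ℝ → ℤ := fun θ =>
    pairCount z t (‖w‖ * exp (θ * I)) s - pairCount z' t' (‖w‖ * exp (θ * I)) s
  have hv0 : ∀ θ, v (-θ) = -v θ := fun θ => by
    have := href0 (‖w‖ * exp (θ * I)) s
    have e : conj ((‖w‖ : ℂ) * exp (θ * I)) = ‖w‖ * exp ((-θ : ℝ) * I) := by
      rw [map_mul, conj_ofReal, ← exp_conj, map_mul, conj_ofReal, conj_I]
      congr 2; push_cast; ring
    rw [e] at this
    simp only [v]
    linarith
  have hv1 : ∀ θ, v (2 * α - θ) = -v θ := fun θ => by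
    have := href1 (‖w‖ * exp (θ * I) * c) s
    have e : conj ((‖w‖ : ℂ) * exp (θ * I) * c) = ‖w‖ * exp ((2 * α - θ : ℝ) * I) * c := by
      rw [hc, mul_assoc, mul_assoc, ← exp_add, ← exp_add, map_mul, conj_ofReal, ← exp_conj]
      simp only [map_add, map_mul, map_neg, conj_ofReal, conj_I]
      congr 2; push_cast; ring
    rw [e, pairCount_mul _ _ _ _ hc0, pairCount_mul _ _ _ _ hc0, pairCount_mul _ _ _ _ hc0,
      pairCount_mul _ _ _ _ hc0] at this
    simp only [v]
    linarith
  have hvz : ∀ θ, v θ = 0 := by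
    by_cases hw : ‖w‖ = 0
    · have : ∀ θ, v θ = v 0 := fun θ => by simp [v, hw]
      intro θ
      have h := hv0 0
      rw [neg_zero] at h
      rw [this]; omega
    have hw : 0 < ‖w‖ := lt_of_le_of_ne (norm_nonneg _) (Ne.symm hw)
    refine eq_zero_of_odd_of_reflect hα0 hv0 hv1 fun θ hθ0 hθα => ?_
    -- A point at an angle strictly between `0` and `α` is off the real axis with larger cosine than
    -- `z j`, against `hmax`.
    have key : ∀ k, ‖z k‖ = ‖w‖ → (z k).re = ‖w‖ * Real.cos θ → False := fun k hn hr => by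
      have hlt : Real.cos α < Real.cos θ :=
        Real.strictAntiOn_cos ⟨hθ0.le, by linarith⟩ ⟨hα0.le, hαπ⟩ hθα
      have hs : 0 < Real.sin θ := Real.sin_pos_of_pos_of_lt_pi hθ0 (by linarith)
      have him : (z k).im ≠ 0 := fun h => by
        have h2 := sq_norm_sub_sq_re (z k)
        rw [hn, hr, h] at h2
        have h3 : (‖w‖ * Real.sin θ) ^ 2 = 0 := by
          have := Real.sin_sq_add_cos_sq θ
          linear_combination h2 + ‖w‖ ^ 2 * this
        have : 0 < (‖w‖ * Real.sin θ) ^ 2 := by positivity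
        linarith
      have := hmax k him
      have hre : (z j).re = ‖z j‖ * Real.cos α := by
        rw [hα, norm_mul_cos_arg]
      rw [hn, hr, hre] at this
      have h4 : 0 < ‖w‖ * ‖z j‖ := by positivity
      nlinarith
    have hnw : ‖(‖w‖ : ℂ) * exp (θ * I)‖ = ‖w‖ := by
      rw [norm_mul, norm_exp_ofReal_mul_I]; simp
    have hrw : ((‖w‖ : ℂ) * exp (θ * I)).re = ‖w‖ * Real.cos θ := by
      rw [re_ofReal_mul, exp_ofReal_mul_I_re]
    have e1 : pairCount z t (‖w‖ * exp (θ * I)) s = 0 := by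
      by_contra h
      obtain ⟨k, hk⟩ := exists_of_pairCount_ne_zero h
      exact key k (by rw [hk, hnw]) (by rw [hk, hrw])
    have e2 : pairCount z' t' (‖w‖ * exp (θ * I)) s = 0 := by
      by_contra h
      obtain ⟨k, hk⟩ := exists_of_pairCount_ne_zero h
      -- The norm and real part of a point of `z'` in the sector recur in `z`, so the sector is
      -- empty for `z'` too.
      have := h0 (τ₀.symm k)
      rw [Equiv.apply_symm_apply, hk, hnw, hrw] at this
      exact key (τ₀.symm k) this.2.1.symm this.2.2.symm
    simp only [v]
    rw [e1, e2, sub_zero]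
  have := hvz (arg w)
  simp only [v] at this
  rw [norm_mul_exp_arg_mul_I] at this
  linarith

-- The first projection leaves the sign of the imaginary part of `z' (τ₀ j)` open; conjugating the
-- clouds so that both chosen points lie in the upper half plane reduces to the adjacent case.
open Complex ComplexConjugate in
theorem exists_equiv_of_projections {ι κ : Type*} [Fintype ι] [Fintype κ] {z : ι → ℂ}
    {t : ι → ℝ} {z' : κ → ℂ} {t' : κ → ℝ} (τ₀ : ι ≃ κ)
    (h0 : ∀ k, t' (τ₀ k) = t k ∧ ‖z' (τ₀ k)‖ = ‖z k‖ ∧ (z' (τ₀ k)).re = (z k).re)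
    (h1 : ∀ j, ∃ τ : ι ≃ κ, ∀ k, t' (τ k) = t k ∧ ‖z' (τ k)‖ = ‖z k‖ ∧
      (z' (τ k) * conj (z' (τ₀ j))).re = (z k * conj (z j)).re) :
    ∃ π : ι ≃ κ, (∀ k, t' (π k) = t k) ∧
      ((∀ k, z' (π k) = z k) ∨ ∀ k, z' (π k) = conj (z k)) := by
  classical
  have him : ∀ k, (z' (τ₀ k)).im = (z k).im ∨ (z' (τ₀ k)).im = -(z k).im := fun k => by
    rcases eq_or_eq_conj_of_re_eq_of_norm_eq (h0 k).2.2 (h0 k).2.1 with h | h <;> simp [h]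
  by_cases hall : ∀ k, (z k).im = 0
  · refine ⟨τ₀, fun k => (h0 k).1, .inl fun k => Complex.ext (h0 k).2.2 ?_⟩
    rcases him k with h | h <;> simp [h, hall k]
  push Not at hall
  obtain ⟨j₀, hj₀⟩ := hall
  -- Largest cosine among the points off the real axis: no such point is angularly closer to the
  -- positive real axis.
  obtain ⟨j, hj, hmax⟩ := Finset.exists_max_image (Finset.univ.filter fun k => (z k).im ≠ 0)
    (fun k => (z k).re / ‖z k‖) ⟨j₀, by simpa using hj₀⟩
  simp only [Finset.mem_filter, Finset.mem_univ, true_and] at hj hmax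
  have hpos : ∀ k, (z k).im ≠ 0 → 0 < ‖z k‖ := fun k hk =>
    norm_pos_iff.mpr fun h => hk (by simp [h])
  have hmax' : ∀ k, (z k).im ≠ 0 → (z k).re * ‖z j‖ ≤ (z j).re * ‖z k‖ := fun k hk =>
    (div_le_div_iff₀ (hpos k hk) (hpos j hj)).mp (hmax k hk)
  obtain ⟨τ₁, hτ₁⟩ := h1 j
  have hj' : (z' (τ₀ j)).im ≠ 0 := by
    rcases him j with h | h <;> simp [h, hj]
  rcases lt_or_gt_of_ne hj with hs | hs <;> rcases lt_or_gt_of_ne hj' with hs' | hs'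
  · obtain ⟨π, hπ⟩ := exists_equiv_of_adjacent_projections (z := fun k => conj (z k))
      (z' := fun k => conj (z' k)) (t := t) (t' := t') τ₀ τ₁ j (by simpa using h0)
      (by simpa using hτ₁) (by simpa using hs) (by simpa using hs') (by simpa using hmax')
    exact ⟨π, fun k => (hπ k).2, .inl fun k => (starRingEnd ℂ).injective (hπ k).1⟩
  · obtain ⟨π, hπ⟩ := exists_equiv_of_adjacent_projections (z := fun k => conj (z k))
      (z' := z') (t := t) (t' := t') τ₀ τ₁ j (by simpa using h0)
      (by simpa using hτ₁) (by simpa using hs) (by simpa using hs') (by simpa using hmax')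
    exact ⟨π, fun k => (hπ k).2, .inr fun k => (hπ k).1⟩
  · obtain ⟨π, hπ⟩ := exists_equiv_of_adjacent_projections (z := z)
      (z' := fun k => conj (z' k)) (t := t) (t' := t') τ₀ τ₁ j (by simpa using h0)
      (by simpa using hτ₁) (by simpa using hs) (by simpa using hs') (by simpa using hmax')
    exact ⟨π, fun k => (hπ k).2, .inr fun k => by
      have := (hπ k).1
      rw [← this, conj_conj]⟩
  · obtain ⟨π, hπ⟩ := exists_equiv_of_adjacent_projections τ₀ τ₁ j h0 hτ₁ hs hs' hmax'
    exact ⟨π, fun k => (hπ k).2, .inl fun k => (hπ k).1⟩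

/-! ### Barycenters and squared distances -/

/-- The barycenter of a point cloud for given masses. -/
noncomputable def PointCloud.barycenter {n : ℕ} (P : PointCloud n) (w : Fin n → ℝ) : Space3 :=
  (∑ i, w i)⁻¹ • ∑ i, w i • P i

open RealInnerProductSpace in
/-- Huygens' identity. -/
theorem PointCloud.sum_mul_dist_sq {n : ℕ} (P : PointCloud n) {w : Fin n → ℝ}
    (hw : ∑ i, w i ≠ 0) (x : Space3) :
    ∑ k, w k * dist x (P k) ^ 2 =
      (∑ k, w k) * dist x (P.barycenter w) ^ 2 + ∑ k, w k * dist (P.barycenter w) (P k) ^ 2 := by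
  set c := P.barycenter w with hc
  have h0 : ∑ k, w k • (c - P k) = 0 := by
    simp only [smul_sub, Finset.sum_sub_distrib]
    rw [← Finset.sum_smul, hc, PointCloud.barycenter, smul_inv_smul₀ hw, sub_self]
  have h1 : ∑ k, w k * ⟪x - c, c - P k⟫ = 0 := by
    simp only [← inner_smul_right]
    rw [← inner_sum, h0, inner_zero_right]
  have h2 : ∀ k, w k * dist x (P k) ^ 2 =
      w k * dist x c ^ 2 + 2 * (w k * ⟪x - c, c - P k⟫) + w k * dist c (P k) ^ 2 := fun k => by
    rw [dist_eq_norm, dist_eq_norm, dist_eq_norm, show x - P k = (x - c) + (c - P k) by abel,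
      norm_add_sq_real]
    ring
  rw [Finset.sum_congr rfl fun k _ => h2 k, Finset.sum_add_distrib, Finset.sum_add_distrib,
    ← Finset.mul_sum, h1, ← Finset.sum_mul]
  ring

/-- Averaging Huygens' identity over the nodes makes its two terms equal, so the moment about the
barycenter can be read off from pairwise distances. -/
theorem PointCloud.sum_mul_sum_mul_dist_sq {n : ℕ} (P : PointCloud n) {w : Fin n → ℝ}
    (hw : ∑ i, w i ≠ 0) :
    ∑ i, w i * ∑ k, w k * dist (P i) (P k) ^ 2 =
      2 * ((∑ k, w k) * ∑ k, w k * dist (P.barycenter w) (P k) ^ 2) := by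
  rw [Finset.sum_congr rfl fun i _ => by rw [P.sum_mul_dist_sq hw (P i)]]
  simp only [mul_add, Finset.sum_add_distrib]
  rw [← Finset.sum_mul, two_mul, Finset.mul_sum]
  congr 1
  refine Finset.sum_congr rfl fun i _ => ?_
  rw [dist_comm]; ring

/-- Distances to the barycenter are determined by the weighted sums of squared distances. -/
theorem PointCloud.dist_barycenter_eq {n n' : ℕ} (P : PointCloud n) (P' : PointCloud n')
    {w : Fin n → ℝ} {w' : Fin n' → ℝ} (hw : ∑ i, w i ≠ 0) (σ : Fin n ≃ Fin n')
    (hσ : ∀ i, w' (σ i) = w i)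
    (hS : ∀ i, ∑ k, w' k * dist (P' (σ i)) (P' k) ^ 2 = ∑ k, w k * dist (P i) (P k) ^ 2)
    {x x' : Space3} (hx : ∑ k, w' k * dist x' (P' k) ^ 2 = ∑ k, w k * dist x (P k) ^ 2) :
    dist x' (P'.barycenter w') = dist x (P.barycenter w) := by
  have hsum : ∑ i, w' i = ∑ i, w i := by
    rw [← Equiv.sum_comp σ]; exact Finset.sum_congr rfl fun i _ => hσ i
  have hw' : ∑ i, w' i ≠ 0 := hsum ▸ hw
  have hI := P'.sum_mul_sum_mul_dist_sq hw'
  rw [← Equiv.sum_comp σ, Finset.sum_congr rfl fun i _ => by rw [hσ i, hS i],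
    P.sum_mul_sum_mul_dist_sq hw, hsum] at hI
  have hI' := mul_left_cancel₀ hw (mul_left_cancel₀ two_ne_zero hI)
  rw [P'.sum_mul_dist_sq hw', P.sum_mul_dist_sq hw, hsum, hI'] at hx
  have := mul_left_cancel₀ hw (add_right_cancel hx)
  exact (sq_eq_sq₀ dist_nonneg dist_nonneg).mp this

/-! ### Frames in three-space -/

theorem Space3.norm_sq (v : Space3) : ‖v‖ ^ 2 = v 0 ^ 2 + v 1 ^ 2 + v 2 ^ 2 := by
  rw [EuclideanSpace.real_norm_sq_eq, Fin.sum_univ_three]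

theorem Space3.dist_sq (v w : Space3) :
    dist v w ^ 2 = (v 0 - w 0) ^ 2 + (v 1 - w 1) ^ 2 + (v 2 - w 2) ^ 2 := by
  rw [dist_eq_norm, Space3.norm_sq]; rfl

/-- A linear isometry moves `u` to the positive third axis and `v` to the half plane spanned by the
third and the positive first axis. -/
theorem Space3.exists_frame (u v : Space3) : ∃ R : Space3 ≃ₗᵢ[ℝ] Space3,
    R u = !₂[0, 0, ‖u‖] ∧ (R v) 1 = 0 ∧ 0 ≤ (R v) 0 := by
  have hn1 : ‖u‖ = ‖(!₂[0, 0, ‖u‖] : Space3)‖ := by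
    rw [← sq_eq_sq₀ (norm_nonneg _) (norm_nonneg _), Space3.norm_sq !₂[0, 0, ‖u‖]]
    simp
  set R₁ := (ℝ ∙ (u - (!₂[0, 0, ‖u‖] : Space3)))ᗮ.reflection
  have h1 : R₁ u = !₂[0, 0, ‖u‖] := Submodule.reflection_sub hn1
  set v₁ := R₁ v
  set w : Space3 := !₂[√(v₁ 0 ^ 2 + v₁ 1 ^ 2), 0, v₁ 2] with hw
  have hn2 : ‖v₁‖ = ‖w‖ := by
    rw [← sq_eq_sq₀ (norm_nonneg _) (norm_nonneg _), Space3.norm_sq, Space3.norm_sq, hw]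
    have : √(v₁ 0 ^ 2 + v₁ 1 ^ 2) ^ 2 = v₁ 0 ^ 2 + v₁ 1 ^ 2 := Real.sq_sqrt (by positivity)
    simp [this]
  set R₂ := (ℝ ∙ (v₁ - w))ᗮ.reflection
  have h2 : R₂ v₁ = w := Submodule.reflection_sub hn2
  -- `v₁ - w` has vanishing third coordinate, so the second reflection fixes the axis.
  have h3 : R₂ !₂[0, 0, ‖u‖] = !₂[0, 0, ‖u‖] := by
    refine Submodule.reflection_mem_subspace_eq_self ?_
    rw [Submodule.mem_orthogonal_singleton_iff_inner_left]
    simp [PiLp.inner_apply, Fin.sum_univ_three, hw]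
  refine ⟨R₁.trans R₂, ?_, ?_, ?_⟩
  · rw [LinearIsometryEquiv.trans_apply, h1, h3]
  · rw [LinearIsometryEquiv.trans_apply, h2]; simp [hw]
  · rw [LinearIsometryEquiv.trans_apply, h2]; simp [hw]

/-- The reflection in the plane of the first and third axes. -/
theorem Space3.exists_flip : ∃ D : Space3 ≃ₗᵢ[ℝ] Space3,
    ∀ v, (D v) 0 = v 0 ∧ (D v) 1 = -v 1 ∧ (D v) 2 = v 2 :=
  ⟨LinearIsometryEquiv.piLpCongrRight 2 fun i : Fin 3 =>
    if i = 1 then LinearIsometryEquiv.neg ℝ else LinearIsometryEquiv.refl ℝ ℝ, fun v => by simp⟩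

/-! ### What embeddings determine -/

namespace DisGNN

variable {M : DisGNN} {n n' : ℕ} {P : PointCloud n} {P' : PointCloud n'}

theorem embed_eq_of_succ (hM : M.IsInjective) {l : ℕ} {i : Fin n} {i' : Fin n'}
    (h : M.embed P' (l + 1) i' = M.embed P (l + 1) i) : M.embed P' l i' = M.embed P l i :=
  (Prod.mk.inj ((hM l).2 (a₁ := (_, _)) (a₂ := (_, _)) h)).1

theorem embed_eq_of_le (hM : M.IsInjective) {l l' : ℕ} (hl : l ≤ l') {i : Fin n} {i' : Fin n'}
    (h : M.embed P' l' i' = M.embed P l' i) : M.embed P' l i' = M.embed P l i := by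
  induction l', hl using Nat.le_induction with
  | base => exact h
  | succ l' _ ih => exact ih (embed_eq_of_succ hM h)

theorem exists_equiv_of_embed_succ_eq (hM : M.IsInjective) {l : ℕ} {i : Fin n} {i' : Fin n'}
    (h : M.embed P' (l + 1) i' = M.embed P (l + 1) i) :
    ∃ τ : Fin n ≃ Fin n', ∀ k, M.embed P' l (τ k) = M.embed P l k ∧
      dist (P' i') (P' (τ k)) = dist (P i) (P k) := by
  have := (hM l).1 (Prod.mk.inj ((hM l).2 (a₁ := (_, _)) (a₂ := (_, _)) h)).2
  obtain ⟨τ, hτ⟩ := exists_equiv_of_map_univ_eq this.symm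
  exact ⟨τ, fun k => Prod.mk.inj (hτ k)⟩

/-- The barycenter of a point cloud for masses depending on the embeddings in round `l`. -/
noncomputable def massCenter (M : DisGNN) (P : PointCloud n) (l : ℕ)
    (m : Feature (M.dim l) → ℝ) : Space3 :=
  P.barycenter fun i => m (M.embed P l i)

theorem sum_mul_dist_sq_eq (hM : M.IsInjective) {l : ℕ} (m : Feature (M.dim l) → ℝ) {i : Fin n}
    {i' : Fin n'} (h : M.embed P' (l + 1) i' = M.embed P (l + 1) i) :
    ∑ k, m (M.embed P' l k) * dist (P' i') (P' k) ^ 2 =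
      ∑ k, m (M.embed P l k) * dist (P i) (P k) ^ 2 := by
  obtain ⟨τ, hτ⟩ := exists_equiv_of_embed_succ_eq hM h
  rw [← Equiv.sum_comp τ]
  exact Finset.sum_congr rfl fun k _ => by rw [(hτ k).1, (hτ k).2]

theorem dist_massCenter_eq (hM : M.IsInjective) {l : ℕ} (σ : Fin n ≃ Fin n')
    (hσ : ∀ i, M.embed P' (l + 1) (σ i) = M.embed P (l + 1) i) {m : Feature (M.dim l) → ℝ}
    (hm : ∑ i, m (M.embed P l i) ≠ 0) {i : Fin n} {i' : Fin n'}
    (h : M.embed P' (l + 1) i' = M.embed P (l + 1) i) :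
    dist (P' i') (M.massCenter P' l m) = dist (P i) (M.massCenter P l m) :=
  P.dist_barycenter_eq P' hm σ (fun i => by rw [embed_eq_of_succ hM (hσ i)])
    (fun i => sum_mul_dist_sq_eq hM m (hσ i)) (sum_mul_dist_sq_eq hM m h)

/-- The first barycenter serves as the probe point for the second: its distances to all nodes are
already known. -/
theorem dist_massCenter_massCenter_eq (hM : M.IsInjective) {l : ℕ} (σ : Fin n ≃ Fin n')
    (hσ : ∀ i, M.embed P' (l + 1) (σ i) = M.embed P (l + 1) i) {m₁ m₂ : Feature (M.dim l) → ℝ}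
    (hm₁ : ∑ i, m₁ (M.embed P l i) ≠ 0) (hm₂ : ∑ i, m₂ (M.embed P l i) ≠ 0) :
    dist (M.massCenter P' l m₁) (M.massCenter P' l m₂) =
      dist (M.massCenter P l m₁) (M.massCenter P l m₂) := by
  refine P.dist_barycenter_eq P' hm₂ σ (fun i => by rw [embed_eq_of_succ hM (hσ i)])
    (fun i => sum_mul_dist_sq_eq hM m₂ (hσ i)) ?_
  rw [← Equiv.sum_comp σ]
  refine Finset.sum_congr rfl fun k _ => ?_
  rw [embed_eq_of_succ hM (hσ k), dist_comm, dist_massCenter_eq hM σ hσ hm₁ (hσ k), dist_comm]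

/-! ### Stabilization of the partition -/

/-- The bijection behind equality in round `l + 1` preserves classes of round `l`, hence by
hypothesis those of round `l + 1`, so the next messages agree. -/
theorem embed_refines_succ (hM : M.IsInjective) {l : ℕ}
    (h : ∀ i j, M.embed P l i = M.embed P l j → M.embed P (l + 1) i = M.embed P (l + 1) j) :
    ∀ i j, M.embed P (l + 1) i = M.embed P (l + 1) j →
      M.embed P (l + 2) i = M.embed P (l + 2) j := by
  intro i j hij
  obtain ⟨τ, hτ⟩ := exists_equiv_of_embed_succ_eq hM hij
  change M.update _ _ (M.aggr _ _) = M.update _ _ (M.aggr _ _)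
  rw [hij]
  congr 2
  rw [← Finset.map_univ_equiv τ, Finset.map_val, Multiset.map_map]
  refine Multiset.map_congr (by simp) fun k _ => ?_
  simp [(hτ k).2, h _ _ (hτ k).1]

theorem stableFrom_of_succ (hM : M.IsInjective) {T : ℕ}
    (h : ∀ i j, M.embed P T i = M.embed P T j → M.embed P (T + 1) i = M.embed P (T + 1) j) :
    M.StableFrom P T := by
  have hs : ∀ l, T ≤ l → ∀ i j, M.embed P l i = M.embed P l j →
      M.embed P (l + 1) i = M.embed P (l + 1) j := fun l hl => by
    induction l, hl using Nat.le_induction with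
    | base => exact h
    | succ l _ ih => exact embed_refines_succ hM ih
  intro l hl i j
  refine ⟨embed_eq_of_le hM hl, fun hij => ?_⟩
  induction l, hl using Nat.le_induction with
  | base => exact hij
  | succ l hl ih => exact hs l hl i j ih

/-- Until the partition is stable the number of classes grows every round, and it is at most `n`. -/
theorem exists_stableFrom (hM : M.IsInjective) (P : PointCloud n) :
    ∃ T ≤ n, M.StableFrom P T := by
  classical
  by_contra! hcon
  have hlt : ∀ l ≤ n, (Finset.univ.image (M.embed P l)).card <
      (Finset.univ.image (M.embed P (l + 1))).card := fun l hl => by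
    by_contra! hle
    refine hcon l hl (stableFrom_of_succ hM fun i j hij => ?_)
    have hfac : Function.FactorsThrough (M.embed P l) (M.embed P (l + 1)) :=
      fun a b hab => embed_eq_of_succ hM hab
    -- The coarsening map from classes of round `l + 1` to those of round `l`; without growth it is
    -- injective.
    set ψ := Function.extend (M.embed P (l + 1)) (M.embed P l) fun _ => 0
    have hψ : ∀ a, ψ (M.embed P (l + 1) a) = M.embed P l a := hfac.extend_apply _
    have himg : (Finset.univ.image (M.embed P (l + 1))).image ψ =
        Finset.univ.image (M.embed P l) := by
      rw [Finset.image_image]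
      exact Finset.image_congr fun a _ => hψ a
    have hinj := Finset.card_image_iff.mp
      (le_antisymm Finset.card_image_le (himg ▸ hle))
    exact hinj (by simp) (by simp) (by rw [hψ, hψ, hij])
  have hge : ∀ l ≤ n + 1, l ≤ (Finset.univ.image (M.embed P l)).card := fun l => by
    induction l with
    | zero => simp
    | succ l ih => exact fun hl => lt_of_le_of_lt (ih (by omega)) (hlt l (by omega))
  have h1 := hge (n + 1) le_rfl
  have h2 : (Finset.univ.image (M.embed P (n + 1))).card ≤ n :=
    Finset.card_image_le.trans (by simp)
  omega

theorem stableFrom_stableRound (hM : M.IsInjective) (P : PointCloud n) :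
    M.StableFrom P (M.stableRound P) :=
  let ⟨T, _, hT⟩ := exists_stableFrom hM P
  Nat.sInf_mem (s := {T | M.StableFrom P T}) ⟨T, hT⟩

theorem stableRound_le (hM : M.IsInjective) (P : PointCloud n) : M.stableRound P ≤ n :=
  let ⟨_, hn, hT⟩ := exists_stableFrom hM P
  (Nat.sInf_le hT).trans hn

/-! ### Center distances and reconstruction from an axis -/

theorem centerEncoding_eq_of_encoding_eq (hM : M.IsInjective) {i j : Fin n}
    (h : M.encoding P i = M.encoding P j) : centerEncoding P i = centerEncoding P j := by
  have hc : M.massCenter P (M.stableRound P) (fun _ => 1) = P.center := by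
    simp [massCenter, PointCloud.barycenter, PointCloud.center]
  rw [centerEncoding, centerEncoding, ← hc]
  have hn : (n : ℝ) ≠ 0 := Nat.cast_ne_zero.mpr i.pos.ne'
  exact dist_massCenter_eq hM (Equiv.refl _) (fun _ => rfl) (by simpa using hn)
    ((stableFrom_stableRound hM P _ (Nat.le_succ _) i j).mpr h)

/-- Embeddings that agree for three rounds after round `l`, at which there are two distinct centers
of mass, determine the point cloud. -/
theorem isomorphic_of_embed_eq (hM : M.IsInjective) {l : ℕ} (σ : Fin n ≃ Fin n')
    (hσ : ∀ i, M.embed P' (l + 3) (σ i) = M.embed P (l + 3) i) {m₁ m₂ : Feature (M.dim l) → ℝ}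
    (hm₁ : ∑ i, m₁ (M.embed P l i) ≠ 0) (hm₂ : ∑ i, m₂ (M.embed P l i) ≠ 0)
    (hne : M.massCenter P l m₁ ≠ M.massCenter P l m₂) : P.Isomorphic P' := by
  have hσ1 : ∀ i, M.embed P' (l + 1) (σ i) = M.embed P (l + 1) i :=
    fun i => embed_eq_of_le hM (by omega) (hσ i)
  have hd₁ := fun {i i'} => dist_massCenter_eq (i := i) (i' := i') hM σ hσ1 hm₁
  have hd₂ := fun {i i'} => dist_massCenter_eq (i := i) (i' := i') hM σ hσ1 hm₂
  have hd := dist_massCenter_massCenter_eq hM σ hσ1 hm₁ hm₂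
  set c₁ := M.massCenter P l m₁
  set c₂ := M.massCenter P l m₂
  set c₁' := M.massCenter P' l m₁
  set c₂' := M.massCenter P' l m₂
  suffices hfr : ∃ (R R' : Space3 ≃ₗᵢ[ℝ] Space3) (π : Fin n ≃ Fin n'),
      ∀ k, R' (P' (π k) - c₁') = R (P k - c₁) by
    obtain ⟨R, R', π, h⟩ := hfr
    refine ⟨π, R.trans R'.symm, c₁' - R'.symm (R c₁), fun k => ?_⟩
    have := congrArg R'.symm (h k)
    rw [LinearIsometryEquiv.symm_apply_apply, map_sub, map_sub] at this
    rw [LinearIsometryEquiv.trans_apply, ← sub_add_cancel (P' (π k)) c₁', this]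
    abel
  have hframe : ∃ ρ : Space3 → ℝ, ∀ v v' : Space3, ∃ R R' : Space3 ≃ₗᵢ[ℝ] Space3,
      (∀ x, (R x) 0 ^ 2 + (R x) 1 ^ 2 = ρ x) ∧
      (R v) 1 = 0 ∧ 0 ≤ (R v) 0 ∧ (R' v') 1 = 0 ∧ 0 ≤ (R' v') 0 ∧
      ∀ k k', M.embed P' (l + 1) k' = M.embed P (l + 1) k →
        (R' (P' k' - c₁')) 2 = (R (P k - c₁)) 2 ∧
        (R' (P' k' - c₁')) 0 ^ 2 + (R' (P' k' - c₁')) 1 ^ 2 =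
          (R (P k - c₁)) 0 ^ 2 + (R (P k - c₁)) 1 ^ 2 := by
    -- Squared distance to the axis. It is independent of the frame, so an off-axis node can be
    -- chosen before the frame adapted to it.
    refine ⟨fun x => ‖x‖ ^ 2 - (inner ℝ x (c₂ - c₁) / ‖c₂ - c₁‖) ^ 2, fun v v' => ?_⟩
    obtain ⟨R, hR, hv1, hv0⟩ := Space3.exists_frame (c₂ - c₁) v
    obtain ⟨R', hR', hv1', hv0'⟩ := Space3.exists_frame (c₂' - c₁') v'
    have hpos : 0 < ‖c₂ - c₁‖ := norm_pos_iff.mpr (sub_ne_zero.mpr hne.symm)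
    refine ⟨R, R', fun x => ?_, hv1, hv0, hv1', hv0', fun k k' hk => ?_⟩
    · beta_reduce
      rw [← R.inner_map_map, ← R.norm_map x, hR, Space3.norm_sq]
      simp [PiLp.inner_apply, Fin.sum_univ_three, hpos.ne']
    have hdist : ‖c₂' - c₁'‖ = ‖c₂ - c₁‖ := by
      rw [← dist_eq_norm, ← dist_eq_norm, dist_comm, hd, dist_comm]
    rw [hdist] at hR'
    have e1 : ‖R' (P' k' - c₁')‖ = ‖R (P k - c₁)‖ := by
      rw [LinearIsometryEquiv.norm_map, LinearIsometryEquiv.norm_map, ← dist_eq_norm,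
        ← dist_eq_norm, hd₁ hk]
    have e2 : dist (R' (P' k' - c₁')) (R' (c₂' - c₁')) = dist (R (P k - c₁)) (R (c₂ - c₁)) := by
      rw [LinearIsometryEquiv.dist_map, LinearIsometryEquiv.dist_map, dist_sub_right,
        dist_sub_right, hd₂ hk]
    rw [hR, hR'] at e2
    have e1 := congrArg (· ^ 2) e1
    have e2 := congrArg (· ^ 2) e2
    simp only [Space3.norm_sq, Space3.dist_sq] at e1 e2
    simp at e2
    -- The squared distances to the two centers differ by an affine function of the height with
    -- slope proportional to `‖c₂ - c₁‖`.
    have e3 : (R' (P' k' - c₁')) 2 = (R (P k - c₁)) 2 :=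
      mul_left_cancel₀ hpos.ne' (by simp only [PiLp.sub_apply, map_sub] at *; linarith)
    refine ⟨e3, ?_⟩
    rw [e3] at e1
    linarith
  obtain ⟨ρ, hframe⟩ := hframe
  -- If all nodes lie on the axis, heights alone determine the cloud and `σ` itself is the matching.
  by_cases hρ : ∀ i, ρ (P i - c₁) = 0
  · obtain ⟨R, R', hR, -, -, -, -, hm⟩ := hframe 0 0
    refine ⟨R, R', σ, fun k => ?_⟩
    obtain ⟨h2, h01⟩ := hm k (σ k) (hσ1 k)
    rw [hR, hρ k] at h01
    have h0 := hR (P k - c₁)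
    rw [hρ k] at h0
    obtain ⟨a0, a1⟩ : (R (P k - c₁)) 0 = 0 ∧ (R (P k - c₁)) 1 = 0 :=
      ⟨by nlinarith, by nlinarith⟩
    obtain ⟨b0, b1⟩ : (R' (P' (σ k) - c₁')) 0 = 0 ∧ (R' (P' (σ k) - c₁')) 1 = 0 :=
      ⟨by nlinarith, by nlinarith⟩
    ext c
    fin_cases c
    · exact b0.trans a0.symm
    · exact b1.trans a1.symm
    · exact h2
  push Not at hρ
  obtain ⟨i, hi⟩ := hρ
  obtain ⟨R, R', hR, hi1, hi0, hi1', hi0', hm⟩ := hframe (P i - c₁) (P' (σ i) - c₁')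
  set q : Fin n → Space3 := fun k => R (P k - c₁) with hq
  set q' : Fin n' → Space3 := fun k => R' (P' k - c₁') with hq'
  change (q i) 1 = 0 at hi1
  change 0 ≤ (q i) 0 at hi0
  change (q' (σ i)) 1 = 0 at hi1'
  change 0 ≤ (q' (σ i)) 0 at hi0'
  have hm : ∀ k k', M.embed P' (l + 1) k' = M.embed P (l + 1) k →
      (q' k') 2 = (q k) 2 ∧ (q' k') 0 ^ 2 + (q' k') 1 ^ 2 = (q k) 0 ^ 2 + (q k) 1 ^ 2 := hm
  have hpos : 0 < (q i) 0 := by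
    refine lt_of_le_of_ne hi0 fun h => hi ?_
    rw [← hR]
    change (q i) 0 ^ 2 + (q i) 1 ^ 2 = 0
    rw [← h, hi1]; ring
  have hii : (q' (σ i)) 0 = (q i) 0 := by
    have := (hm i (σ i) (hσ1 i)).2
    rw [hi1, hi1'] at this
    exact (sq_eq_sq₀ hi0' hi0).mp (by linarith)
  have hprod : ∀ j j' k k', M.embed P' (l + 1) j' = M.embed P (l + 1) j →
      M.embed P' (l + 1) k' = M.embed P (l + 1) k →
      dist (P' j') (P' k') = dist (P j) (P k) →
      (q' k') 0 * (q' j') 0 + (q' k') 1 * (q' j') 1 = (q k) 0 * (q j) 0 + (q k) 1 * (q j) 1 := by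
    intro j j' k k' hj hk hjk
    have e : dist (q' j') (q' k') ^ 2 = dist (q j) (q k) ^ 2 := by
      simp only [hq, hq', LinearIsometryEquiv.dist_map, dist_sub_right, hjk]
    rw [Space3.dist_sq, Space3.dist_sq, (hm j j' hj).1, (hm k k' hk).1] at e
    linarith [(hm j j' hj).2, (hm k k' hk).2]
  -- `τ₀` preserves embeddings of round `l + 2`, leaving one round to unroll at each `j` below and
  -- still keep round `l + 1`, which fixes heights and radii.
  obtain ⟨τ₀, hτ₀⟩ := exists_equiv_of_embed_succ_eq hM (hσ i)
  have hτ₀1 : ∀ k, M.embed P' (l + 1) (τ₀ k) = M.embed P (l + 1) k :=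
    fun k => embed_eq_of_succ hM (hτ₀ k).1
  let z : Fin n → ℂ := fun k => ⟨(q k) 0, (q k) 1⟩
  let z' : Fin n' → ℂ := fun k => ⟨(q' k) 0, (q' k) 1⟩
  have hnorm : ∀ k k', M.embed P' (l + 1) k' = M.embed P (l + 1) k → ‖z' k'‖ = ‖z k‖ := by
    intro k k' hk
    rw [← sq_eq_sq₀ (norm_nonneg _) (norm_nonneg _), Complex.sq_norm, Complex.sq_norm,
      Complex.normSq_mk, Complex.normSq_mk]
    linarith [(hm k k' hk).2]
  obtain ⟨π, hπ2, hπ⟩ := exists_equiv_of_projections (z := z) (z' := z')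
    (t := fun k => (q k) 2) (t' := fun k => (q' k) 2) τ₀
    (fun k => by
      refine ⟨(hm _ _ (hτ₀1 k)).1, hnorm _ _ (hτ₀1 k), ?_⟩
      have := hprod i (σ i) k (τ₀ k) (hσ1 i) (hτ₀1 k) (hτ₀ k).2
      rw [hi1, hi1', hii, mul_zero, mul_zero, add_zero, add_zero] at this
      exact mul_right_cancel₀ hpos.ne' this)
    (fun j => by
      obtain ⟨τ, hτ⟩ := exists_equiv_of_embed_succ_eq hM (hτ₀ j).1
      refine ⟨τ, fun k => ⟨(hm _ _ (hτ k).1).1, hnorm _ _ (hτ k).1, ?_⟩⟩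
      simpa [z, z'] using hprod j (τ₀ j) k (τ k) (hτ₀1 j) (hτ k).1 (hτ k).2)
  rcases hπ with hπ | hπ
  · refine ⟨R, R', π, fun k => ?_⟩
    ext c
    fin_cases c
    · exact congrArg Complex.re (hπ k)
    · exact congrArg Complex.im (hπ k)
    · exact hπ2 k
  · obtain ⟨D, hD⟩ := Space3.exists_flip
    refine ⟨R.trans D, R', π, fun k => ?_⟩
    ext c
    fin_cases c
    · exact (congrArg Complex.re (hπ k)).trans (hD (q k)).1.symm
    · exact (congrArg Complex.im (hπ k)).trans (hD (q k)).2.1.symm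
    · exact (hπ2 k).trans (hD (q k)).2.2.symm

end DisGNN

/-! ### Center sets and the main theorem -/

theorem centerSet_nonempty {n : ℕ} {X : Type*} (hn : n ≠ 0) (P : PointCloud n) (x : Fin n → X) :
    (centerSet P x).Nonempty :=
  ⟨_, fun _ => 1, by simpa using hn, rfl⟩

/-- Finer features give more barycenters. -/
theorem centerSet_subset {n : ℕ} {X Y : Type*} (P : PointCloud n) {x : Fin n → X} {y : Fin n → Y}
    (h : ∀ i j, y i = y j → x i = x j) : centerSet P x ⊆ centerSet P y := by
  rintro c ⟨m, hm, rfl⟩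
  have hext : ∀ i, Function.extend y (m ∘ x) 0 (y i) = m (x i) :=
    Function.FactorsThrough.extend_apply (fun i j hij => congrArg m (h i j hij)) 0
  exact ⟨Function.extend y (m ∘ x) 0, by simpa only [hext] using hm, by simp only [hext]⟩

theorem IsAsymmetric.mono {n : ℕ} {X Y : Type*} {P : PointCloud n} {x : Fin n → X} {y : Fin n → Y}
    (h : ∀ i j, y i = y j → x i = x j) (hx : IsAsymmetric P x) : IsAsymmetric P y := by
  intro hy
  -- Without nodes every total mass is zero, so both center sets are empty.
  rcases eq_or_ne n 0 with rfl | hn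
  · exact hx ((congrArg Set.encard (Set.Subset.antisymm (centerSet_subset P h)
      (centerSet_subset P fun i => i.elim0))).trans hy)
  obtain ⟨c, hc⟩ := Set.encard_eq_one.mp hy
  refine hx (Set.encard_eq_one.mpr ⟨c, ?_⟩)
  exact (centerSet_nonempty hn P x).subset_singleton_iff.mp (hc ▸ centerSet_subset P h)

theorem theorem1 {n : ℕ} (P : PointCloud n) (M : DisGNN) (hM : M.IsInjective) :
    (IsAsymmetric P (centerEncoding P) → IsAsymmetric P (M.encoding P)) ∧
    (IsAsymmetric P (M.encoding P) →
      ∀ (L k : ℕ) (fout : Multiset (Feature (M.dim L)) → Feature k),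
        n + 4 ≤ L → Function.Injective fout → Identifies (M.output L fout) P) := by
  refine ⟨IsAsymmetric.mono fun i j => DisGNN.centerEncoding_eq_of_encoding_eq hM, ?_⟩
  intro hP L k fout hL hf n' P' hiso heq
  apply hiso
  obtain ⟨σ, hσ⟩ := exists_equiv_of_map_univ_eq (hf heq)
  -- The empty cloud is asymmetric without having two centers, so it is treated apart.
  rcases eq_or_ne n 0 with rfl | hn
  · exact ⟨σ, LinearIsometryEquiv.refl ℝ _, 0, fun i => i.elim0⟩
  have hnt : (centerSet P (M.encoding P)).Nontrivial := by
    by_contra h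
    rcases (Set.not_nontrivial_iff.mp h).eq_empty_or_singleton with h | ⟨c, h⟩
    · exact (centerSet_nonempty hn P _).ne_empty h
    · exact hP (Set.encard_eq_one.mpr ⟨c, h⟩)
  obtain ⟨_, ⟨m₁, hm₁, rfl⟩, _, ⟨m₂, hm₂, rfl⟩, hne⟩ := hnt
  have hT := DisGNN.stableRound_le hM P
  exact DisGNN.isomorphic_of_embed_eq hM σ
    (fun i => DisGNN.embed_eq_of_le hM (by omega) (hσ i)) hm₁ hm₂ hne
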